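/- Let $(W,S)$ be a finite Coxeter system, and let $T=\bigcup_{w\in W}wSw^{-1}$ be its set of reflections. A parabolic subgroup of $W$ is a subgroup of the form $w\langle I\rangle w^{-1}$ with $I\subseteq S$ and $w\in W$; for $u\in W$, the parabolic closure $P(u)$ is the smallest parabolic subgroup of $W$ containing $u$. A parabolic subgroup $P$ is called involutive if there is $x\in W$ with $x^2=1$ and $P(x)=P$. Every parabolic subgroup $P$ is a Coxeter group with respect to its canonical set of generators $\{t\in T\mid N(t)\cap P=\{t\}\}$, where $N(w)=\{r\in T\mid \ell_S(rw)<\ell_S(w)\}$ for $w\in W$, and the longest element of $P$ is its unique element of maximal length with respect to these generators. Then for every $u\in W$ one has $u^2=1$ if and only if $u$ is the longest element of $P(u)$. In particular, for every involutive parabolic subgroup $P$ of $W$ there is a unique $u\in P$ such that $u^2=1$ and $P=P(u)$. -/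

import Mathlib

namespace CoxeterSystem

variable {B W : Type*} [Group W] {M : CoxeterMatrix B} (cs : CoxeterSystem M W)

/-- The standard parabolic subgroup `W_I`, generated by the simple reflections indexed by `I`. -/
def standardParabolic (I : Set B) : Subgroup W :=
  Subgroup.closure (cs.simple '' I)

/-- A parabolic subgroup is a conjugate `w W_I w⁻¹` of a standard parabolic subgroup. -/
def IsParabolic (P : Subgroup W) : Prop :=
  ∃ (w : W) (I : Set B), P = (cs.standardParabolic I).map (MulAut.conj w).toMonoidHom

/-- The parabolic closure `P(w)`: the intersection of all parabolic subgroups containing `w`. -/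
def parabolicClosure (w : W) : Subgroup W :=
  sInf {P : Subgroup W | cs.IsParabolic P ∧ w ∈ P}

/-- A parabolic subgroup is involutive if it is the parabolic closure of some `x` with
`x ^ 2 = 1`. -/
def IsInvolutive (P : Subgroup W) : Prop :=
  cs.IsParabolic P ∧ ∃ x : W, x ^ 2 = 1 ∧ cs.parabolicClosure x = P

/-- The canonical Coxeter generators of a reflection subgroup `P` (Dyer, Deodhar): the reflections
`t` with `N(t) ∩ P = {t}`, where `N(t)` is the set of left inversions of `t`. -/
def canonicalGenerators (P : Subgroup W) : Set W :=
  {t | cs.IsReflection t ∧ {r | cs.IsLeftInversion t r ∧ r ∈ P} = {t}}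

/-- The length of `x` with respect to the canonical Coxeter generators of `P`: the least number of
factors in an expression of `x` as a product of canonical generators of `P`. It is meant for `x` in
a reflection subgroup `P`, which is generated by its canonical generators. -/
noncomputable def lengthIn (P : Subgroup W) (x : W) : ℕ :=
  sInf {n | ∃ l : List W, (∀ t ∈ l, t ∈ cs.canonicalGenerators P) ∧ l.prod = x ∧ l.length = n}

/-- `u` is the longest element of `P`, viewed as a Coxeter group through its canonical generators:
every other element of `P` is strictly shorter. -/
def IsLongestElement (P : Subgroup W) (u : W) : Prop :=
  u ∈ P ∧ ∀ x ∈ P, x ≠ u → cs.lengthIn P x < cs.lengthIn P u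

end CoxeterSystem

/-!
For a word and a reflection `t`, the parity of the number of occurrences of `t` in the left
inversion sequence depends only on the product `w` of the word, and it is odd exactly when
`t ∈ N(w)`. Hence `N(xy) = N(x) ∆ x N(y) x⁻¹`, from which everything else follows.

If an involution `u` does not commute with some left descent `s`, then `s u s` is shorter than `u`.
Descending, `u = x a x⁻¹` where `a` commutes with all its left descents `J`, and such an involution
`a` is the longest element of `W_J` and central in it. Each simple reflection in `J` is an inversion
of `a` commuting with `a`, so the cocycle identity puts it into every parabolic subgroup containing
`a`; hence `P(u) = x W_J x⁻¹`. As `a` is central in `W_J`, we may choose `x` of minimal length in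
`x W_J`, and then conjugation by `x` carries the simple reflections of `W_J` to the canonical
generators of `P(u)`, and so the longest element `a` to the longest element `u`.

Conversely, inversion preserves the length with respect to the canonical generators, so a longest
element is its own inverse.
-/

namespace CoxeterInvolution

open CoxeterSystem

variable {B W : Type*} [Group W] {M : CoxeterMatrix B} {cs : CoxeterSystem M W}

/-! ### The inversion cocycle -/

theorem prod_map_alternatingWord {G : Type*} [Monoid G] (f : B → G) (i j : B) (m : ℕ) :
    ((alternatingWord i j (2 * m)).map f).prod = (f i * f j) ^ m := by
  induction m with
  | zero => simp [alternatingWord]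
  | succ m ih =>
    rw [show 2 * (m + 1) = 2 * m + 1 + 1 by ring, alternatingWord_succ, alternatingWord_succ]
    simp [ih, pow_succ]

/-- The action of `W` on functions `W → ℤˣ` induced by conjugation. The signs recording inversions
form a cocycle for this action, that is, a lift of `W` to the semidirect product. -/
def conjArrow (W : Type*) [Group W] : W →* MulAut (W → ℤˣ) :=
  mulAutArrow.comp MulAut.conj

theorem conjArrow_apply (x : W) (f : W → ℤˣ) (t : W) : conjArrow W x f t = f (x⁻¹ * t * x) := by
  change f ((MulAut.conj x)⁻¹ • t) = _
  rw [← map_inv, MulAut.smul_def, MulAut.conj_apply, inv_inv]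

section InversionSign

variable (cs)

theorem drop_leftInvSeq_alternatingWord (i j : B) :
    (cs.leftInvSeq (alternatingWord i j (2 * M i j))).drop (M i j) =
      (cs.leftInvSeq (alternatingWord i j (2 * M i j))).take (M i j) := by
  apply List.ext_getElem
  · simp only [List.length_drop, List.length_take, length_leftInvSeq, length_alternatingWord]
    lia
  · intro k _ hk
    simp only [List.length_take, length_leftInvSeq, length_alternatingWord] at hk
    rw [List.getElem_drop, List.getElem_take,
      cs.getElem_leftInvSeq_alternatingWord i j _ _ (by lia),
      cs.getElem_leftInvSeq_alternatingWord i j _ _ (by lia),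
      prod_alternatingWord_eq_mul_pow, prod_alternatingWord_eq_mul_pow]
    have half_shifted : (2 * (M i j + k) + 1) / 2 = M i j + k := by lia
    have half : (2 * k + 1) / 2 = k := by lia
    simp [half_shifted, half, pow_add]

open Classical in
theorem even_count_leftInvSeq_alternatingWord (i j : B) (t : W) :
    Even ((cs.leftInvSeq (alternatingWord i j (2 * M i j))).count t) := by
  rw [← List.take_append_drop (M i j) (cs.leftInvSeq (alternatingWord i j (2 * M i j))),
    drop_leftInvSeq_alternatingWord, List.count_append]
  exact Even.add_self _

open Classical in
/-- The lift of a simple reflection to `(W → ℤˣ) ⋊ W` whose sign is `-1` exactly at that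
reflection. -/
noncomputable def signedSimple (i : B) : (W → ℤˣ) ⋊[conjArrow W] W :=
  ⟨Pi.mulSingle (cs.simple i) (-1), cs.simple i⟩

open Classical in
theorem prod_map_signedSimple (ω : List B) :
    (ω.map (signedSimple cs)).prod =
      ⟨fun t ↦ (-1) ^ (cs.leftInvSeq ω).count t, cs.wordProd ω⟩ := by
  induction ω with
  | nil => ext <;> simp
  | cons i ω ih =>
    rw [List.map_cons, List.prod_cons, ih]
    refine SemidirectProduct.ext (funext fun t ↦ ?_) (cs.wordProd_cons i ω).symm
    have ht : t = MulAut.conj (cs.simple i) ((cs.simple i)⁻¹ * t * cs.simple i) := by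
      rw [MulAut.conj_apply]; group
    have hcount : (cs.leftInvSeq (i :: ω)).count t =
        (cs.leftInvSeq ω).count ((cs.simple i)⁻¹ * t * cs.simple i) +
          if t = cs.simple i then 1 else 0 := by
      rw [leftInvSeq, List.count_cons]
      nth_rw 1 [ht]
      rw [List.count_map_of_injective _ _ (MulAut.conj (cs.simple i)).injective]
      simp only [beq_iff_eq, eq_comm (a := t)]
    change _ = (-1) ^ (cs.leftInvSeq (i :: ω)).count t
    rw [SemidirectProduct.mul_left, Pi.mul_apply, hcount, pow_add, mul_comm]
    simp only [signedSimple, conjArrow_apply, Pi.mulSingle_apply, pow_ite, pow_one, pow_zero]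

theorem isLiftable_signedSimple : M.IsLiftable (signedSimple cs) := by
  classical
  intro i j
  rw [← prod_map_alternatingWord, prod_map_signedSimple]
  refine SemidirectProduct.ext (funext fun t ↦ ?_) ?_
  · exact (even_count_leftInvSeq_alternatingWord cs i j t).neg_one_pow
  · simp [prod_alternatingWord_eq_mul_pow]

/-- The lift of `W` to the semidirect product `(W → ℤˣ) ⋊ W` extending `signedSimple`. -/
noncomputable def signedLift : W →* (W → ℤˣ) ⋊[conjArrow W] W :=
  cs.lift ⟨signedSimple cs, isLiftable_signedSimple cs⟩

/-- The sign `(-1) ^ n`, where `n` is the number of occurrences of `t` in the left inversion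
sequence of any word for `w`. -/
noncomputable def inversionSign (w t : W) : ℤˣ :=
  (signedLift cs w).left t

theorem signedLift_wordProd (ω : List B) :
    signedLift cs (cs.wordProd ω) = (ω.map (signedSimple cs)).prod := by
  rw [wordProd, map_list_prod, List.map_map]
  congr 2
  exact funext fun i ↦ cs.lift_apply_simple (isLiftable_signedSimple cs) i

theorem signedLift_right (w : W) : (signedLift cs w).right = w := by
  classical
  obtain ⟨ω, rfl⟩ := cs.wordProd_surjective w
  rw [signedLift_wordProd, prod_map_signedSimple]

open Classical in
theorem inversionSign_wordProd (ω : List B) (t : W) :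
    inversionSign cs (cs.wordProd ω) t = (-1) ^ (cs.leftInvSeq ω).count t := by
  rw [inversionSign, signedLift_wordProd, prod_map_signedSimple]

theorem inversionSign_one (t : W) : inversionSign cs 1 t = 1 := by
  simp [inversionSign]

theorem inversionSign_mul (x y t : W) :
    inversionSign cs (x * y) t = inversionSign cs x t * inversionSign cs y (x⁻¹ * t * x) := by
  rw [inversionSign, map_mul, SemidirectProduct.mul_left, Pi.mul_apply, signedLift_right,
    conjArrow_apply, inversionSign, inversionSign]

theorem inversionSign_inv (x t : W) :
    inversionSign cs x⁻¹ (x⁻¹ * t * x) = inversionSign cs x t := by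
  have h := inversionSign_mul cs x x⁻¹ t
  rw [mul_inv_cancel, inversionSign_one] at h
  rw [eq_inv_of_mul_eq_one_right h.symm, Int.units_inv_eq_self]

theorem inversionSign_simple_self (i : B) :
    inversionSign cs (cs.simple i) (cs.simple i) = -1 := by
  classical
  rw [← wordProd_singleton, inversionSign_wordProd]
  simp

end InversionSign

theorem inversionSign_self {t : W} (ht : cs.IsReflection t) : inversionSign cs t t = -1 := by
  obtain ⟨x, i, rfl⟩ := ht
  have conj_back : x⁻¹ * (x * cs.simple i * x⁻¹) * x = cs.simple i := by group
  have conj_back' : (x * cs.simple i)⁻¹ * (x * cs.simple i * x⁻¹) * (x * cs.simple i) =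
      x⁻¹ * (x * cs.simple i * x⁻¹) * x := by group
  rw [inversionSign_mul, inversionSign_mul, conj_back', inversionSign_inv, conj_back,
    inversionSign_simple_self, mul_right_comm, Int.units_mul_self, one_mul]

theorem mem_leftInvSeq_of_inversionSign {ω : List B} {t : W}
    (h : inversionSign cs (cs.wordProd ω) t = -1) : t ∈ cs.leftInvSeq ω := by
  classical
  by_contra hmem
  rw [inversionSign_wordProd, List.count_eq_zero_of_not_mem hmem, pow_zero] at h
  exact absurd h (by decide)

theorem isLeftInversion_of_inversionSign {w t : W} (h : inversionSign cs w t = -1) :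
    cs.IsLeftInversion w t := by
  obtain ⟨ω, hω, rfl⟩ := cs.exists_isReduced w
  exact cs.isLeftInversion_of_mem_leftInvSeq hω (mem_leftInvSeq_of_inversionSign h)

theorem isLeftInversion_iff_inversionSign {w t : W} (ht : cs.IsReflection t) :
    cs.IsLeftInversion w t ↔ inversionSign cs w t = -1 := by
  refine ⟨fun h ↦ ?_, isLeftInversion_of_inversionSign⟩
  by_contra hne
  have hpos : inversionSign cs w t = 1 := (Int.units_eq_one_or _).resolve_right hne
  -- Otherwise `t` would be an inversion of `t * w` as well.
  refine ht.isLeftInversion_mul_right_iff.mp (isLeftInversion_of_inversionSign ?_) h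
  rw [inversionSign_mul, inversionSign_self ht, inv_mul_cancel, one_mul, hpos, mul_one]

theorem isLeftInversion_mul_iff {t : W} (ht : cs.IsReflection t) (x y : W) :
    cs.IsLeftInversion (x * y) t ↔
      Xor (cs.IsLeftInversion x t) (cs.IsLeftInversion y (x⁻¹ * t * x)) := by
  have ht' : cs.IsReflection (x⁻¹ * t * x) := by simpa using ht.conj x⁻¹
  rw [isLeftInversion_iff_inversionSign ht, isLeftInversion_iff_inversionSign ht,
    isLeftInversion_iff_inversionSign ht', inversionSign_mul]
  generalize inversionSign cs x t = a
  generalize inversionSign cs y (x⁻¹ * t * x) = b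
  revert a b
  decide

theorem mem_leftInvSeq_of_isLeftInversion {ω : List B} {t : W}
    (h : cs.IsLeftInversion (cs.wordProd ω) t) : t ∈ cs.leftInvSeq ω :=
  mem_leftInvSeq_of_inversionSign ((isLeftInversion_iff_inversionSign h.1).mp h)

theorem isLeftInversion_simple_iff_eq {i : B} {t : W} :
    cs.IsLeftInversion (cs.simple i) t ↔ t = cs.simple i := by
  refine ⟨fun h ↦ ?_, ?_⟩
  · simpa using mem_leftInvSeq_of_isLeftInversion (ω := [i]) (by simpa using h)
  · rintro rfl
    simp [IsLeftInversion, isReflection_simple]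

theorem isLeftInversion_self_conj_iff {x r : W} :
    cs.IsLeftInversion x (x * r * x⁻¹) ↔ cs.IsRightInversion x r := by
  rw [IsLeftInversion, IsRightInversion, isReflection_conj_iff, inv_mul_cancel_right]

theorem isLeftInversion_conj_iff {r : W} (hr : cs.IsReflection r) (x h : W) :
    cs.IsLeftInversion (x * h * x⁻¹) (x * r * x⁻¹) ↔
      Xor (cs.IsRightInversion x r)
        (Xor (cs.IsLeftInversion h r) (cs.IsRightInversion x (h⁻¹ * r * h))) := by
  have conj_back : x⁻¹ * (x * r * x⁻¹) * x = r := by group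
  rw [mul_assoc x h, isLeftInversion_mul_iff (hr.conj x), isLeftInversion_self_conj_iff, conj_back,
    isLeftInversion_mul_iff hr, isLeftInversion_inv_iff]

theorem isLeftInversion_conj_iff_of_commute {h r : W} (hr : cs.IsReflection r) (hc : Commute h r)
    (x : W) : cs.IsLeftInversion (x * h * x⁻¹) (x * r * x⁻¹) ↔ cs.IsLeftInversion h r := by
  have conj_eq : h⁻¹ * r * h = r := by rw [mul_assoc, ← hc.eq, inv_mul_cancel_left]
  rw [isLeftInversion_conj_iff hr, conj_eq]
  grind

theorem length_inv_simple_mul_mul_lt {i : B} {h u : W} (hu : cs.IsLeftDescent u i)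
    (hh : ¬ cs.IsLeftDescent h i) :
    cs.length ((cs.simple i * h)⁻¹ * u) < cs.length (h⁻¹ * u) := by
  have hinv : cs.IsLeftInversion (h * (h⁻¹ * u)) (cs.simple i) := by
    rwa [mul_inv_cancel_left, isLeftInversion_simple_iff_isLeftDescent]
  rw [isLeftInversion_mul_iff (cs.isReflection_simple i),
    isLeftInversion_simple_iff_isLeftDescent] at hinv
  have hlt := (hinv.or.resolve_left hh).2
  rwa [show h⁻¹ * cs.simple i * h * (h⁻¹ * u) = (cs.simple i * h)⁻¹ * u by
    simp [mul_assoc]] at hlt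

theorem length_conj_simple_lt {u : W} {i : B} (hl : cs.IsLeftDescent u i)
    (hr : cs.IsRightDescent u i) (hne : ¬ Commute u (cs.simple i)) :
    cs.length (cs.simple i * u * cs.simple i) < cs.length u := by
  have hconj : u⁻¹ * cs.simple i * u ≠ cs.simple i := fun h ↦ hne <| by
    rwa [mul_assoc, inv_mul_eq_iff_eq_mul, eq_comm] at h
  have hinv : cs.IsLeftInversion (u * cs.simple i) (cs.simple i) := by
    rw [isLeftInversion_mul_iff (cs.isReflection_simple i), isLeftInversion_simple_iff_eq,
      isLeftInversion_simple_iff_isLeftDescent]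
    exact Or.inl ⟨hl, hconj⟩
  rw [mul_assoc]
  exact hinv.2.trans hr

/-! ### Standard parabolic subgroups -/

section StandardParabolic

variable {J : Set B} {h u x : W}

theorem simple_mem_standardParabolic {i : B} (hi : i ∈ J) :
    cs.simple i ∈ cs.standardParabolic J :=
  Subgroup.subset_closure ⟨i, hi, rfl⟩

theorem standardParabolic_induction_left {p : ∀ w, w ∈ cs.standardParabolic J → Prop}
    (one : p 1 (one_mem _))
    (simple_mul : ∀ i (hi : i ∈ J) w (hw : w ∈ cs.standardParabolic J), p w hw →
      p (cs.simple i * w) (mul_mem (simple_mem_standardParabolic hi) hw))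
    (hh : h ∈ cs.standardParabolic J) : p h hh := by
  induction hh using Subgroup.closure_induction_left with
  | one => exact one
  | mul_left _ hs w hw ih =>
    obtain ⟨i, hi, rfl⟩ := hs
    exact simple_mul i hi w hw ih
  | inv_mul_cancel _ hs w hw ih =>
    obtain ⟨i, hi, rfl⟩ := hs
    simpa only [inv_simple] using simple_mul i hi w hw ih

theorem exists_isReduced_of_mem_standardParabolic (hh : h ∈ cs.standardParabolic J) :
    ∃ ω : List B, (∀ i ∈ ω, i ∈ J) ∧ cs.IsReduced ω ∧ h = cs.wordProd ω := by
  induction hh using standardParabolic_induction_left with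
  | one => exact ⟨[], by simp, by simp [CoxeterSystem.IsReduced], by simp⟩
  | simple_mul i hi w _ ih =>
    obtain ⟨ω, hωJ, hω, rfl⟩ := ih
    rcases cs.length_simple_mul (cs.wordProd ω) i with hl | hl
    · refine ⟨i :: ω, by simpa [hi] using hωJ, ?_, (cs.wordProd_cons i ω).symm⟩
      rw [CoxeterSystem.IsReduced, wordProd_cons, hl, hω.eq, List.length_cons]
    · have hinv : cs.IsLeftInversion (cs.wordProd ω) (cs.simple i) :=
        ⟨cs.isReflection_simple i, by lia⟩
      obtain ⟨k, hk, hki⟩ := List.mem_iff_getElem.mp (mem_leftInvSeq_of_isLeftInversion hinv)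
      have hdel : cs.simple i * cs.wordProd ω = cs.wordProd (ω.eraseIdx k) := by
        rw [← getD_leftInvSeq_mul_wordProd, List.getD_eq_getElem _ 1 hk, hki]
      refine ⟨ω.eraseIdx k, fun j hj ↦ hωJ j (List.mem_of_mem_eraseIdx hj), ?_, hdel⟩
      rw [length_leftInvSeq] at hk
      have hlen := List.length_eraseIdx_add_one hk
      have hred := hω.eq
      rw [CoxeterSystem.IsReduced, ← hdel]
      lia

theorem exists_isLeftDescent_of_mem_standardParabolic (hh : h ∈ cs.standardParabolic J)
    (hne : h ≠ 1) : ∃ i ∈ J, cs.IsLeftDescent h i := by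
  obtain ⟨_ | ⟨i, ω⟩, hωJ, hω, rfl⟩ := exists_isReduced_of_mem_standardParabolic hh
  · simp at hne
  · refine ⟨i, hωJ i List.mem_cons_self, ?_⟩
    rw [IsLeftDescent, hω.eq, wordProd_cons, simple_mul_simple_cancel_left, List.length_cons]
    exact Nat.lt_succ_of_le (cs.length_wordProd_le ω)

theorem mem_standardParabolic_of_isLeftInversion {t : W} (hh : h ∈ cs.standardParabolic J)
    (ht : cs.IsLeftInversion h t) : t ∈ cs.standardParabolic J := by
  induction hh using standardParabolic_induction_left generalizing t with
  | one => exact absurd ht.2 (by simp)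
  | simple_mul i hi w _ ih =>
    have hiJ := simple_mem_standardParabolic (cs := cs) hi
    rcases ((isLeftInversion_mul_iff ht.1 _ _).mp ht).or with hsimple | hconj
    · rwa [isLeftInversion_simple_iff_eq.mp hsimple]
    · have hmem := ih hconj
      rwa [Subgroup.mul_mem_cancel_right _ hiJ, Subgroup.mul_mem_cancel_left _ (inv_mem hiJ)]
        at hmem

theorem length_add_length_inv_mul (hu : ∀ i ∈ J, cs.IsLeftDescent u i)
    (hh : h ∈ cs.standardParabolic J) : cs.length h + cs.length (h⁻¹ * u) = cs.length u := by
  obtain ⟨ω, hωJ, hω, rfl⟩ := exists_isReduced_of_mem_standardParabolic hh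
  clear hh
  induction ω with
  | nil => simp
  | cons i ω ih =>
    have hω' : cs.IsReduced ω := by simpa using hω.drop 1
    have hadd_tail := ih (fun j hj ↦ hωJ j (List.mem_cons_of_mem _ hj)) hω'
    have hlen : cs.length (cs.simple i * cs.wordProd ω) = cs.length (cs.wordProd ω) + 1 := by
      rw [← wordProd_cons, hω.eq, hω'.eq, List.length_cons]
    have hlt := length_inv_simple_mul_mul_lt (hu i (hωJ i List.mem_cons_self))
      (cs.not_isLeftDescent_iff.mpr hlen)
    have hle := cs.length_mul_le (cs.simple i * cs.wordProd ω) ((cs.simple i * cs.wordProd ω)⁻¹ * u)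
    rw [mul_inv_cancel_left] at hle
    rw [wordProd_cons]
    lia

variable (cs J) in
/-- `x` has minimal length in its left coset `x W_J`. -/
def IsMinCosetRep (x : W) : Prop :=
  ∀ h ∈ cs.standardParabolic J, cs.length x ≤ cs.length (x * h)

variable (cs J) in
theorem exists_isMinCosetRep_mul (x : W) :
    ∃ y ∈ cs.standardParabolic J, IsMinCosetRep cs J (x * y) := by
  obtain ⟨y, hy, hmin⟩ := exists_minimalFor_of_wellFoundedLT (· ∈ cs.standardParabolic J)
    (fun y ↦ cs.length (x * y)) ⟨1, one_mem _⟩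
  refine ⟨y, hy, fun h hh ↦ ?_⟩
  rw [mul_assoc]
  exact (le_total _ _).elim id (hmin (mul_mem hy hh))

theorem IsMinCosetRep.not_isRightInversion (hx : IsMinCosetRep cs J x)
    (hh : h ∈ cs.standardParabolic J) : ¬ cs.IsRightInversion x h :=
  fun hinv ↦ (hx h hh).not_gt hinv.2

theorem IsMinCosetRep.isLeftInversion_conj_iff {r : W} (hx : IsMinCosetRep cs J x)
    (hh : h ∈ cs.standardParabolic J) (hr : r ∈ cs.standardParabolic J) :
    cs.IsLeftInversion (x * h * x⁻¹) (x * r * x⁻¹) ↔ cs.IsLeftInversion h r := by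
  by_cases hrefl : cs.IsReflection r
  · have hr' := hx.not_isRightInversion (mul_mem (mul_mem (inv_mem hh) hr) hh)
    rw [CoxeterInvolution.isLeftInversion_conj_iff hrefl]
    simp only [hx.not_isRightInversion hr, hr', xor_comm, xor_false, id]
  · exact iff_of_false (fun hinv ↦ hrefl ((cs.isReflection_conj_iff x r).mp hinv.1))
      fun hinv ↦ hrefl hinv.1

end StandardParabolic

/-! ### Parabolic subgroups and their canonical generators -/

section Parabolic

variable {J : Set B} {g h x : W} {P : Subgroup W}

variable (cs) in
/-- The parabolic subgroup `x W_J x⁻¹`, in the form in which it occurs in `IsParabolic`. -/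
abbrev conjParabolic (x : W) (J : Set B) : Subgroup W :=
  (cs.standardParabolic J).map (MulAut.conj x).toMonoidHom

theorem mem_conjParabolic_iff :
    g ∈ conjParabolic cs x J ↔ ∃ h ∈ cs.standardParabolic J, x * h * x⁻¹ = g :=
  Iff.rfl

theorem conj_mem_conjParabolic_iff :
    x * h * x⁻¹ ∈ conjParabolic cs x J ↔ h ∈ cs.standardParabolic J := by
  simp

theorem isParabolic_comap_conj (hP : cs.IsParabolic P) (x : W) :
    cs.IsParabolic (P.comap (MulAut.conj x).toMonoidHom) := by
  obtain ⟨w, J, rfl⟩ := hP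
  refine ⟨x⁻¹ * w, J, ?_⟩
  ext g
  simp only [Subgroup.mem_comap, mem_conjParabolic_iff]
  refine exists_congr fun h ↦ and_congr_right fun _ ↦ ?_
  change w * h * w⁻¹ = x * g * x⁻¹ ↔ _
  rw [eq_mul_inv_iff_mul_eq, ← inv_mul_eq_iff_eq_mul, mul_inv_rev, inv_inv]
  simp only [mul_assoc]

theorem mem_of_isLeftInversion_of_commute {t : W} (hP : cs.IsParabolic P) (hg : g ∈ P)
    (ht : cs.IsLeftInversion g t) (hc : Commute g t) : t ∈ P := by
  obtain ⟨w, J, rfl⟩ := hP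
  obtain ⟨h, hh, rfl⟩ := mem_conjParabolic_iff.mp hg
  obtain ⟨r, rfl⟩ : ∃ r, w * r * w⁻¹ = t := ⟨w⁻¹ * t * w, by group⟩
  rw [isLeftInversion_conj_iff_of_commute ((cs.isReflection_conj_iff w r).mp ht.1)
    ((Commute.conj_iff w).mp hc)] at ht
  exact conj_mem_conjParabolic_iff.mpr (mem_standardParabolic_of_isLeftInversion hh ht)

variable (cs J) in
theorem canonicalGenerators_standardParabolic :
    cs.canonicalGenerators (cs.standardParabolic J) = cs.simple '' J := by
  ext t
  constructor
  · rintro ⟨hrefl, hN⟩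
    have htJ : t ∈ cs.standardParabolic J := (hN.ge (Set.mem_singleton t)).2
    have hne : t ≠ 1 := by
      rintro rfl
      simpa using hrefl.odd_length
    obtain ⟨i, hi, hdesc⟩ := exists_isLeftDescent_of_mem_standardParabolic htJ hne
    exact ⟨i, hi, hN.le ⟨⟨cs.isReflection_simple i, hdesc⟩, simple_mem_standardParabolic hi⟩⟩
  · rintro ⟨i, hi, rfl⟩
    refine ⟨cs.isReflection_simple i, Set.ext fun r ↦ ?_⟩
    simp only [isLeftInversion_simple_iff_eq, Set.mem_ofPred_eq, Set.mem_singleton_iff,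
      and_iff_left_iff_imp]
    rintro rfl
    exact simple_mem_standardParabolic hi

namespace IsMinCosetRep

theorem setOf_isLeftInversion_conj (hx : IsMinCosetRep cs J x)
    (hh : h ∈ cs.standardParabolic J) :
    {r | cs.IsLeftInversion (x * h * x⁻¹) r ∧ r ∈ conjParabolic cs x J} =
      MulAut.conj x '' {r | cs.IsLeftInversion h r ∧ r ∈ cs.standardParabolic J} := by
  ext q
  constructor
  · rintro ⟨hq, r, hr, rfl⟩
    exact ⟨r, ⟨(hx.isLeftInversion_conj_iff hh hr).mp hq, hr⟩, rfl⟩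
  · rintro ⟨r, ⟨hinv, hr⟩, rfl⟩
    exact ⟨(hx.isLeftInversion_conj_iff hh hr).mpr hinv, r, hr, rfl⟩

theorem canonicalGenerators_conjParabolic (hx : IsMinCosetRep cs J x) :
    cs.canonicalGenerators (conjParabolic cs x J) =
      MulAut.conj x '' cs.canonicalGenerators (cs.standardParabolic J) := by
  have conj_mem_iff : ∀ r ∈ cs.standardParabolic J,
      x * r * x⁻¹ ∈ cs.canonicalGenerators (conjParabolic cs x J) ↔
        r ∈ cs.canonicalGenerators (cs.standardParabolic J) := fun r hr ↦ by
    simp only [canonicalGenerators, Set.mem_ofPred_eq, isReflection_conj_iff,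
      hx.setOf_isLeftInversion_conj hr]
    rw [← MulAut.conj_apply, ← Set.image_singleton,
      (MulAut.conj x).injective.image_injective.eq_iff]
  ext t
  constructor
  · intro ht
    obtain ⟨r, hr, rfl⟩ := (ht.2.ge (Set.mem_singleton t)).2
    exact ⟨r, (conj_mem_iff r hr).mp ht, rfl⟩
  · rintro ⟨r, hr, rfl⟩
    exact (conj_mem_iff r (hr.2.ge (Set.mem_singleton r)).2).mpr hr

theorem lengthIn_conj (hx : IsMinCosetRep cs J x) (hh : h ∈ cs.standardParabolic J) :
    cs.lengthIn (conjParabolic cs x J) (x * h * x⁻¹) = cs.length h := by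
  have prod_map_conj (ω : List B) :
      (ω.map fun i ↦ MulAut.conj x (cs.simple i)).prod = x * cs.wordProd ω * x⁻¹ := by
    rw [← MulAut.conj_apply, wordProd, map_list_prod, List.map_map]
    rfl
  rw [lengthIn, hx.canonicalGenerators_conjParabolic, canonicalGenerators_standardParabolic,
    Set.image_image]
  refine IsLeast.csInf_eq ⟨?_, ?_⟩
  · obtain ⟨ω, hωJ, hω, rfl⟩ := exists_isReduced_of_mem_standardParabolic hh
    refine ⟨ω.map fun i ↦ MulAut.conj x (cs.simple i), fun t ht ↦ ?_, prod_map_conj ω, ?_⟩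
    · obtain ⟨i, hi, rfl⟩ := List.mem_map.mp ht
      exact ⟨i, hωJ i hi, rfl⟩
    · rw [List.length_map, hω.eq]
  · rintro _ ⟨l, hl, hprod, rfl⟩
    obtain ⟨ω, rfl⟩ : l ∈ Set.range (List.map fun i ↦ MulAut.conj x (cs.simple i)) := by
      rw [Set.range_list_map]
      exact fun t ht ↦ Set.image_subset_range _ _ (hl t ht)
    rw [prod_map_conj, mul_left_inj, mul_right_inj] at hprod
    rw [← hprod, List.length_map]
    exact cs.length_wordProd_le ω

end IsMinCosetRep

theorem lengthIn_inv (P : Subgroup W) (x : W) : cs.lengthIn P x⁻¹ = cs.lengthIn P x := by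
  have prod_reverse (l : List W) (hl : ∀ t ∈ l, t ∈ cs.canonicalGenerators P) :
      l.reverse.prod = l.prod⁻¹ := by
    rw [List.prod_inv_reverse, List.map_congr_left fun t ht ↦ (hl t ht).1.inv, List.map_id']
  refine congrArg sInf (Set.ext fun n ↦ ⟨?_, ?_⟩)
  all_goals
    rintro ⟨l, hl, hprod, hlen⟩
    refine ⟨l.reverse, by simpa using hl, ?_, by simpa using hlen⟩
    simp [prod_reverse l hl, hprod]

theorem sq_eq_one_of_isLongestElement (hg : cs.IsLongestElement P g) : g ^ 2 = 1 := by
  have hinv : g⁻¹ = g := by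
    by_contra hne
    exact (hg.2 _ (inv_mem hg.1) hne).ne (lengthIn_inv P g)
  rw [pow_two, ← inv_eq_iff_mul_eq_one, hinv]

theorem isLongestElement_unique (hg : cs.IsLongestElement P g) (hh : cs.IsLongestElement P h) :
    g = h := by
  by_contra hne
  exact lt_asymm (hg.2 h hh.1 (Ne.symm hne)) (hh.2 g hg.1 hne)

end Parabolic

/-! ### Involutions -/

variable (cs) in
/-- `a` is the longest element of `W_J`, expressed by its left descents, and is central in `W_J`. -/
structure IsCentralLongest (J : Set B) (a : W) : Prop where
  mem : a ∈ cs.standardParabolic J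
  isLeftDescent : ∀ i ∈ J, cs.IsLeftDescent a i
  commute_simple : ∀ i ∈ J, Commute a (cs.simple i)

namespace IsCentralLongest

variable {J : Set B} {a h x : W} {P : Subgroup W}

theorem commute (ha : IsCentralLongest cs J a) (hh : h ∈ cs.standardParabolic J) :
    Commute a h := by
  induction hh using standardParabolic_induction_left with
  | one => exact Commute.one_right a
  | simple_mul i hi w _ ih => exact (ha.commute_simple i hi).mul_right ih

theorem length_lt (ha : IsCentralLongest cs J a) (hh : h ∈ cs.standardParabolic J) (hne : h ≠ a) :
    cs.length h < cs.length a := by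
  have hadd := length_add_length_inv_mul ha.isLeftDescent hh
  have hpos : cs.length (h⁻¹ * a) ≠ 0 := by
    rwa [Ne, length_eq_zero_iff, inv_mul_eq_one]
  lia

theorem standardParabolic_le (ha : IsCentralLongest cs J a) (hP : cs.IsParabolic P)
    (haP : a ∈ P) : cs.standardParabolic J ≤ P := by
  rw [standardParabolic, Subgroup.closure_le]
  rintro _ ⟨i, hi, rfl⟩
  exact mem_of_isLeftInversion_of_commute hP haP
    ⟨cs.isReflection_simple i, ha.isLeftDescent i hi⟩ (ha.commute_simple i hi)

theorem parabolicClosure_conj (ha : IsCentralLongest cs J a) (x : W) :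
    cs.parabolicClosure (x * a * x⁻¹) = conjParabolic cs x J := by
  apply le_antisymm
  · exact sInf_le ⟨⟨x, J, rfl⟩, conj_mem_conjParabolic_iff.mpr ha.mem⟩
  · refine le_sInf fun P ⟨hP, haP⟩ ↦ ?_
    rw [Subgroup.map_le_iff_le_comap]
    exact ha.standardParabolic_le (isParabolic_comap_conj hP x) haP

theorem isLongestElement_conjParabolic (ha : IsCentralLongest cs J a)
    (hx : IsMinCosetRep cs J x) : cs.IsLongestElement (conjParabolic cs x J) (x * a * x⁻¹) := by
  refine ⟨conj_mem_conjParabolic_iff.mpr ha.mem, fun g hg hne ↦ ?_⟩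
  obtain ⟨h, hh, rfl⟩ := mem_conjParabolic_iff.mp hg
  rw [hx.lengthIn_conj hh, hx.lengthIn_conj ha.mem]
  exact ha.length_lt hh fun heq ↦ hne (heq ▸ rfl)

end IsCentralLongest

section Involution

variable {u : W} (hu : u ^ 2 = 1)
include hu

theorem inv_eq_self_of_sq_eq_one : u⁻¹ = u := by
  rwa [inv_eq_iff_mul_eq_one, ← pow_two]

theorem isRightDescent_iff_isLeftDescent_of_sq_eq_one {i : B} :
    cs.IsRightDescent u i ↔ cs.IsLeftDescent u i := by
  rw [← isRightDescent_inv_iff, inv_eq_self_of_sq_eq_one hu]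

theorem mem_standardParabolic_leftDescents
    (hcomm : ∀ i, cs.IsLeftDescent u i → Commute u (cs.simple i)) :
    u ∈ cs.standardParabolic {i | cs.IsLeftDescent u i} := by
  set J : Set B := {i | cs.IsLeftDescent u i}
  obtain ⟨y, hy, hmin⟩ := exists_isMinCosetRep_mul cs J u
  suffices huy : u * y = 1 by
    rw [eq_inv_of_mul_eq_one_left huy]
    exact inv_mem hy
  by_contra hne
  obtain ⟨i, hi⟩ := cs.exists_leftDescent_of_ne_one hne
  have hadd : cs.length y + cs.length (u * y) = cs.length u := by
    rw [← length_add_length_inv_mul (J := J) (fun i hi ↦ hi) hy, ← cs.length_inv (u * y),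
      mul_inv_rev, inv_eq_self_of_sq_eq_one hu]
  have hiJ : cs.IsLeftDescent u i := by
    have hle := cs.length_mul_le (cs.simple i * (u * y)) y⁻¹
    rw [show cs.simple i * (u * y) * y⁻¹ = cs.simple i * u by group, cs.length_inv] at hle
    rw [IsLeftDescent] at hi ⊢
    lia
  have hsy : cs.simple i * (u * y) = u * y * (y⁻¹ * cs.simple i * y) := by
    rw [← mul_assoc, ← (hcomm i hiJ).eq]
    group
  refine (hmin (y⁻¹ * cs.simple i * y) ?_).not_gt (hsy ▸ hi)
  exact mul_mem (mul_mem (inv_mem hy) (simple_mem_standardParabolic hiJ)) hy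

variable (cs) in
theorem exists_eq_conj_isCentralLongest :
    ∃ (x a : W) (J : Set B), IsCentralLongest cs J a ∧ u = x * a * x⁻¹ := by
  induction hn : cs.length u using Nat.strong_induction_on generalizing u with
  | _ n ih =>
    subst hn
    by_cases hcomm : ∀ i, cs.IsLeftDescent u i → Commute u (cs.simple i)
    · exact ⟨1, u, {i | cs.IsLeftDescent u i},
        ⟨mem_standardParabolic_leftDescents hu hcomm, fun _ ↦ id, hcomm⟩, by simp⟩
    · push Not at hcomm
      obtain ⟨i, hi, hne⟩ := hcomm
      have hsq : (cs.simple i * u * cs.simple i) ^ 2 = 1 := by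
        have hpow := conj_pow (i := 2) (a := cs.simple i) (b := u)
        rwa [inv_simple, hu, mul_one, simple_mul_simple_self] at hpow
      have hlt := length_conj_simple_lt hi
        ((isRightDescent_iff_isLeftDescent_of_sq_eq_one hu).mpr hi) hne
      obtain ⟨x, a, J, ha, hx⟩ := ih _ hlt hsq rfl
      refine ⟨cs.simple i * x, a, J, ha, ?_⟩
      calc u = cs.simple i * (cs.simple i * u * cs.simple i) * cs.simple i := by simp [mul_assoc]
        _ = cs.simple i * x * a * (cs.simple i * x)⁻¹ := by
          rw [hx, mul_inv_rev, inv_simple]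
          group

variable (cs) in
theorem exists_eq_conj_isCentralLongest_isMinCosetRep :
    ∃ (x a : W) (J : Set B), IsCentralLongest cs J a ∧ IsMinCosetRep cs J x ∧ u = x * a * x⁻¹ := by
  obtain ⟨x, a, J, ha, rfl⟩ := exists_eq_conj_isCentralLongest cs hu
  obtain ⟨y, hy, hxy⟩ := exists_isMinCosetRep_mul cs J x
  refine ⟨x * y, a, J, ha, hxy, ?_⟩
  rw [mul_assoc x y a, ← (ha.commute hy).eq]
  group

theorem isLongestElement_parabolicClosure : cs.IsLongestElement (cs.parabolicClosure u) u := by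
  obtain ⟨x, a, J, ha, hx, rfl⟩ := exists_eq_conj_isCentralLongest_isMinCosetRep cs hu
  rw [ha.parabolicClosure_conj]
  exact ha.isLongestElement_conjParabolic hx

end Involution

end CoxeterInvolution

open CoxeterInvolution in
theorem mainTheorem9_general {B W : Type*} [Group W] {M : CoxeterMatrix B}
    (cs : CoxeterSystem M W) :
    (∀ u : W, u ^ 2 = 1 ↔ cs.IsLongestElement (cs.parabolicClosure u) u) ∧
    (∀ P : Subgroup W, cs.IsInvolutive P →
      ∃! u : W, u ∈ P ∧ u ^ 2 = 1 ∧ P = cs.parabolicClosure u) := by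
  refine ⟨fun u ↦ ⟨isLongestElement_parabolicClosure, sq_eq_one_of_isLongestElement⟩, ?_⟩
  rintro _ ⟨-, x, hx, rfl⟩
  have hlongest := isLongestElement_parabolicClosure (cs := cs) hx
  refine ⟨x, ⟨hlongest.1, hx, rfl⟩, ?_⟩
  rintro y ⟨-, hy, hxy⟩
  exact isLongestElement_unique (hxy ▸ isLongestElement_parabolicClosure hy) hlongest

theorem mainTheorem9 {B W : Type*} [Group W] [Finite W] {M : CoxeterMatrix B}
    (cs : CoxeterSystem M W) :
    (∀ u : W, u ^ 2 = 1 ↔ cs.IsLongestElement (cs.parabolicClosure u) u) ∧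
    (∀ P : Subgroup W, cs.IsInvolutive P →
      ∃! u : W, u ∈ P ∧ u ^ 2 = 1 ∧ P = cs.parabolicClosure u) :=
  mainTheorem9_general cs
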